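/- All logarithms are to base $2$. Let $Y$ be a countable discrete output alphabet, $X$ a set of inputs, and $W:X\to\mathcal P(Y)$ a memoryless channel that is Bernoulli-reducible, i.e. whose image $W(X)=\{W(\cdot|x):x\in X\}$ contains a non-constant curve that is continuous in total variation. An $(n,N,\lambda_1,\lambda_2)$ DI code (with $\lambda_1,\lambda_2>0$) is a family $(u_i,D_i)_{i\le N}$ with $u_i\in X^n$ and $D_i\subseteq Y^n$ such that $W^n(D_i|u_i)\ge 1-\lambda_1$ for all $i$, and $W^n(D_j|u_i)\le\lambda_2$ for all $i\ne j$. Its linear rate is $R=\frac1n\log N$. For $L\ge1$ let $\eta(L)=1-\sum_{\ell=1}^{L}2^{-\ell}=2^{-L}$, so that $\eta(L)>0$ and $\eta(L)\to0$ as $L\to\infty$. (i) For every $\delta>0$ and every integer $L\ge 1$ there are a constant $C$ and an $n_0$ (depending only on $W,\delta,L$) such that for all $n\ge n_0$ and all $E$ with $0<E<\frac{1}{\delta\log n}$ there is an $(n,N,L\,2^{-nE},2^{-nE})$ DI code for $W$ with $N\ge1$ and $$\frac1n\log N\;\ge\;\frac{1-\eta(L)}{2}\,\log\Big(\frac1E-\delta\log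 n\Big)-C .$$ (ii) (Leading-order match with the converse for small exponents.) Suppose in addition that $W(X)$ has upper Minkowski dimension $1$ in the Hellinger metric $d(P,Q)^2=\sum_y(\sqrt{P(y)}-\sqrt{Q(y)})^2$, and let $E(n)$ satisfy $nE(n)\to\infty$ and $E(n)\log n\to0$. Then for every $\varepsilon>0$ and all sufficiently large $n$: there is an $(n,N,2^{-nE(n)},2^{-nE(n)})$ DI code for $W$ with $N\ge1$ and $\frac1n\log N\ge(\frac12-\varepsilon)\log\frac1{E(n)}$, and every $(n,N,2^{-nE(n)},2^{-nE(n)})$ DI code for $W$ satisfies $\frac1n\log N\le(\frac12+\varepsilon)\log\frac1{E(n)}$. -/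

import Mathlib

open Filter Topology MeasureTheory
open scoped NNReal ENNReal

noncomputable section

/-- An `(n, N, lam₁, lam₂)` deterministic identification code for the memoryless channel `W`:
code words `u i` and identification regions `D i`, where `W^n(· | u)` is the product measure of the
letterwise output distributions `W (u k)`. -/
structure IsDICode {X Y : Type*} [MeasurableSpace Y] (W : X → PMF Y) (n N : ℕ) (lam₁ lam₂ : ℝ)
    (u : Fin N → Fin n → X) (D : Fin N → Set (Fin n → Y)) : Prop where
  pos₁ : 0 < lam₁
  pos₂ : 0 < lam₂
  missed : ∀ i, 1 - lam₁ ≤ (Measure.pi fun k => (W (u i k)).toMeasure).real (D i)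
  false_id : ∀ i j, i ≠ j → (Measure.pi fun k => (W (u i k)).toMeasure).real (D j) ≤ lam₂

/-- There is an `(n, N, lam₁, lam₂)` deterministic identification code for `W`. -/
def ExistsDICode {X Y : Type*} [MeasurableSpace Y] (W : X → PMF Y) (n N : ℕ) (lam₁ lam₂ : ℝ) :
    Prop :=
  ∃ (u : Fin N → Fin n → X) (D : Fin N → Set (Fin n → Y)), IsDICode W n N lam₁ lam₂ u D

/-- The rate in the linear scale, `R = (log₂ N) / n`. -/
def linearRate (n N : ℕ) : ℝ := Real.logb 2 N / n

/-- `W` is Bernoulli-reducible: its image contains a non-constant continuous curve of output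
distributions. On a discrete alphabet, pointwise convergence of probability mass functions is the
same as convergence in total variation. -/
def BernoulliReducible {X Y : Type*} (W : X → PMF Y) : Prop :=
  ∃ γ : unitInterval → PMF Y, (∀ t, γ t ∈ Set.range W) ∧ (∀ y, Continuous fun t => γ t y) ∧
    ∃ s t, γ s ≠ γ t

/-- `η(L) = 1 - ∑_{ℓ=1}^L 2^{-ℓ}`. -/
def layerLoss (L : ℕ) : ℝ := 1 - ∑ l ∈ Finset.Icc 1 L, (1 / 2 : ℝ) ^ l

lemma layerLoss_eq (L : ℕ) : layerLoss L = (1 / 2 : ℝ) ^ L := by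
  unfold layerLoss
  induction L with
  | zero => simp
  | succ k ih =>
    rw [Finset.sum_Icc_succ_top (by omega), pow_succ]
    linarith [ih, pow_succ (1 / 2 : ℝ) k]

lemma layerLoss_pos (L : ℕ) : 0 < layerLoss L := by
  rw [layerLoss_eq]; positivity

lemma tendsto_layerLoss : Tendsto layerLoss atTop (𝓝 0) := by
  rw [show layerLoss = fun L => (1 / 2 : ℝ) ^ L from funext layerLoss_eq]
  exact tendsto_pow_atTop_nhds_zero_of_lt_one (by norm_num) (by norm_num)

lemma memlp_sqrt_pmf {Y : Type*} (P : PMF Y) :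
    Memℓp (fun y => Real.sqrt (P y).toReal) 2 := by
  rw [memℓp_gen_iff (by norm_num)]
  have h : Summable fun y => (P y).toReal := ENNReal.summable_toReal P.tsum_coe_ne_top
  refine h.congr fun y => ?_
  simp [Real.sq_sqrt ENNReal.toReal_nonneg]

/-- The vector of square roots of the probabilities, a unit vector of `ℓ²(Y)`. The distance of two
such vectors is the Hellinger distance of the distributions (in the unnormalised convention). -/
def sqrtPMF {Y : Type*} (P : PMF Y) : lp (fun _ : Y => ℝ) 2 :=
  ⟨fun y => Real.sqrt (P y).toReal, memlp_sqrt_pmf P⟩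

/-- The upper Minkowski dimension
`limsup_{r → 0+} log (number of r-balls needed to cover A) / log (1 / r)`. -/
def upperMinkowskiDim {M : Type*} [PseudoMetricSpace M] (A : Set M) : EReal :=
  limsup (fun r : ℝ≥0 =>
    ENNReal.log (Metric.coveringNumber r A : ℝ≥0∞) / (Real.log (1 / (r : ℝ)) : EReal)) (𝓝[>] 0)

/-- The upper Minkowski dimension of the image of the channel `W`, taken in the Hellinger metric on
the output distributions. -/
def imageDim {X Y : Type*} (W : X → PMF Y) : EReal :=
  upperMinkowskiDim (Set.range fun x => sqrtPMF (W x))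

end

/-! Achievability. Along the curve the probability of some letter `y₀` sweeps an interval `[a, b]`,
so code words may be taken in `[a, b]ⁿ` and observed through the events `y k = y₀`. A word is
recognised by correlating the output with it: among words on a common sphere, another word lowers
the mean by half the squared distance. For integer words with entries up to `M`, scaled by `s`, the
noise `M n √E` must stay below the signal, of order `n s`, while `s M` stays bounded. One layer
therefore allows only `M` of order `E^(-1/4)`. The gaps of length `s` can be filled by finer layers,
each with its own test; two words are separated by the first layer in which they differ. Passing to
words with equal Gram matrices, at polynomial cost, keeps the finer layers from spoiling that test
(`sum_mul_sub_le_of_gram_eq`). Each layer recovers half of the exponent still missing, whence `1 -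
η(L)` (`exists_layered_code`). The term `δ log n` only weakens the resulting bound.

Converse. Reliable distinction forces a small Bhattacharyya coefficient (`prod_bhattacharyya_le`),
and this coefficient is multiplicative over letters. Words that are letterwise within Hellinger
distance of order `√E` are thus too close, so `N` is at most the `n`-th power of a covering number
at scale `√E` (`card_le_of_isCover`). In dimension 1 this has leading order `1/√E`. -/

/-! ### Reduction to one letter, and concentration -/

/-- Two different distributions on the curve differ at some letter, and the intermediate value
theorem applies to its probability. -/
lemma BernoulliReducible.exists_Icc_subset {X Y : Type*} {W : X → PMF Y}
    (hW : BernoulliReducible W) :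
    ∃ (y₀ : Y) (a b : ℝ), 0 ≤ a ∧ a < b ∧ b ≤ 1 ∧
      ∀ p ∈ Set.Icc a b, ∃ x, (W x y₀).toReal = p := by
  obtain ⟨γ, hγ, hc, s, t, hst⟩ := hW
  obtain ⟨y₀, hy₀⟩ : ∃ y, γ s y ≠ γ t y := by
    by_contra! h
    exact hst (PMF.ext h)
  have hcont : Continuous fun r => (γ r y₀).toReal :=
    ENNReal.continuousOn_toReal.comp_continuous (hc y₀) fun r => PMF.apply_ne_top _ _
  have key : ∀ s t : unitInterval, (γ s y₀).toReal < (γ t y₀).toReal →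
      ∃ (y₀ : Y) (a b : ℝ), 0 ≤ a ∧ a < b ∧ b ≤ 1 ∧
      ∀ p ∈ Set.Icc a b, ∃ x, (W x y₀).toReal = p := by
    intro s t h
    refine ⟨y₀, _, _, ENNReal.toReal_nonneg, h, ?_, fun p hp => ?_⟩
    · exact ENNReal.toReal_mono ENNReal.one_ne_top (PMF.coe_le_one _ _)
    · obtain ⟨r, hr⟩ := intermediate_value_univ s t hcont hp
      obtain ⟨x, hx⟩ := hγ r
      exact ⟨x, by rw [hx]; exact hr⟩
  have hne : (γ s y₀).toReal ≠ (γ t y₀).toReal := fun h =>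
    hy₀ ((ENNReal.toReal_eq_toReal_iff' (PMF.apply_ne_top _ _) (PMF.apply_ne_top _ _)).1 h)
  rcases hne.lt_or_gt with h | h
  · exact key s t h
  · exact key t s h

/-- Hoeffding's inequality for weighted counts of the occurrences of one letter. -/
lemma measureReal_weighted_count_ge_le {Y : Type*} [Countable Y] [MeasurableSpace Y]
    [DiscreteMeasurableSpace Y] {n : ℕ} (P : Fin n → PMF Y) (y₀ : Y) (w : Fin n → ℝ) {M t : ℝ}
    (hw : ∀ k, |w k| ≤ M) (ht : 0 ≤ t) :
    (Measure.pi fun k => (P k).toMeasure).real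
      {y | t ≤ ∑ k, w k * (Set.indicator {y₀} 1 (y k) - (P k y₀).toReal)} ≤
      Real.exp (-(2 * t ^ 2) / (n * M ^ 2)) := by
  classical
  let f : Fin n → Y → ℝ := fun k y => w k * (Set.indicator {y₀} 1 y - (P k y₀).toReal)
  have hf : ∀ k, Measurable (f k) := fun k => Measurable.of_discrete
  have hint : ∀ k, ∫ y, f k y ∂(P k).toMeasure = 0 := by
    intro k
    have h1 : Integrable (fun y => Set.indicator {y₀} (1 : Y → ℝ) y) (P k).toMeasure :=
      (integrable_const (1 : ℝ)).indicator (MeasurableSet.of_discrete)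
    simp only [f]
    rw [integral_const_mul, integral_sub h1 (integrable_const _),
      integral_indicator_one (MeasurableSet.of_discrete)]
    simp [Measure.real, PMF.toMeasure_apply_singleton]
  have hsub : ∀ k ∈ (Finset.univ : Finset (Fin n)), ProbabilityTheory.HasSubgaussianMGF
      (fun y : Fin n → Y => f k (y k)) ((‖M‖₊ / 2) ^ 2)
      (Measure.pi fun k => (P k).toMeasure) := by
    intro k _
    have hmp := measurePreserving_eval (fun k => (P k).toMeasure) k
    refine ProbabilityTheory.HasSubgaussianMGF.of_map (X := f k) (Y := fun y : Fin n → Y => y k)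
      (measurable_pi_apply k).aemeasurable ?_
    rw [hmp.map_eq]
    set c := w k * (P k y₀).toReal with hc
    have hM : 0 ≤ M := (abs_nonneg _).trans (hw k)
    have hv : ∀ y, f k y = w k - c ∨ f k y = -c := by
      intro y
      by_cases hy : y = y₀
      · left; simp [f, hy, hc, mul_sub]
      · right; simp [f, hy, hc]
    have hwk := abs_le.1 (hw k)
    -- Splitting by the sign of the weight keeps both values in an interval of length `M` rather
    -- than `2 * M`, which gives the sharp constant 2 in the exponent.
    rcases le_total 0 (w k) with h0 | h0
    · have := ProbabilityTheory.hasSubgaussianMGF_of_mem_Icc_of_integral_eq_zero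
        (μ := (P k).toMeasure) (X := f k) (a := -c) (b := M - c) (hf k).aemeasurable
        (ae_of_all _ fun y => ?_) (hint k)
      · rwa [show M - c - -c = M by ring] at this
      · rcases hv y with h | h <;> rw [h] <;> constructor <;> linarith
    · have := ProbabilityTheory.hasSubgaussianMGF_of_mem_Icc_of_integral_eq_zero
        (μ := (P k).toMeasure) (X := f k) (a := -M - c) (b := - c) (hf k).aemeasurable
        (ae_of_all _ fun y => ?_) (hint k)
      · rwa [show -c - (-M - c) = M by ring] at this
      · rcases hv y with h | h <;> rw [h] <;> constructor <;> linarith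
  have hind : ProbabilityTheory.iIndepFun (fun k (y : Fin n → Y) => f k (y k))
      (Measure.pi fun k => (P k).toMeasure) :=
    ProbabilityTheory.iIndepFun_pi fun k => (hf k).aemeasurable
  refine (ProbabilityTheory.HasSubgaussianMGF.measure_sum_ge_le_of_iIndepFun hind hsub ht).trans
    (le_of_eq ?_)
  congr 1
  -- If `M = 0` or `n = 0`, both exponents are divisions by zero, hence 0.
  rcases eq_or_ne M 0 with rfl | hM
  · simp
  rcases Nat.eq_zero_or_pos n with rfl | hn
  · simp
  simp [div_pow]
  field_simp

/-! ### Grid packings and words with equal Gram matrices -/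

/-- The full two-sided geometric series has sum 3. -/
lemma sum_range_half_pow_natAbs_le (a M : ℕ) :
    ∑ j ∈ Finset.range M, (1 / 2 : ℝ) ^ ((j : ℤ) - a).natAbs ≤ 3 := by
  have h1 : ∀ M ≤ a, ∑ j ∈ Finset.range M, (1 / 2 : ℝ) ^ ((j : ℤ) - a).natAbs ≤
      (1 / 2 : ℝ) ^ (a - M) := by
    intro M
    induction M with
    | zero => intro _; simp
    | succ M ih =>
      intro hM
      rw [Finset.sum_range_succ, show ((M : ℤ) - a).natAbs = (a - (M + 1)) + 1 by omega]
      have := ih (by omega)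
      rw [show a - M = (a - (M + 1)) + 1 by omega] at this
      rw [pow_succ] at this ⊢
      linarith
  have h2 : ∀ i, ∑ j ∈ Finset.range (a + 1 + i), (1 / 2 : ℝ) ^ ((j : ℤ) - a).natAbs ≤
      3 - (1 / 2 : ℝ) ^ i := by
    intro i
    induction i with
    | zero =>
      have := h1 a le_rfl
      simp only [Nat.sub_self, pow_zero] at this
      rw [add_zero, Finset.sum_range_succ]
      simp only [sub_self, Int.natAbs_zero, pow_zero]
      linarith
    | succ i ih =>
      rw [← add_assoc, Finset.sum_range_succ,
        show (((a + 1 + i : ℕ) : ℤ) - a).natAbs = i + 1 by omega, pow_succ]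
      linarith
  rcases le_or_gt M a with h | h
  · have := h1 M h
    have h3 : (1 / 2 : ℝ) ^ (a - M) ≤ 1 := pow_le_one₀ (by norm_num) (by norm_num)
    linarith
  · obtain ⟨i, rfl⟩ := Nat.exists_eq_add_of_lt h
    have := h2 i
    have h3 : (0 : ℝ) < (1 / 2 : ℝ) ^ i := by positivity
    rw [show a + i + 1 = a + 1 + i by ring]
    linarith

/-- A Euclidean ball of squared radius `n` contains at most `6 ^ n` points of the integer grid. -/
lemma card_grid_ball_le (n m : ℕ) (a : Fin n → ℕ) :
    ((Fintype.piFinset fun _ : Fin n => Finset.range (m + 1)).filter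
      fun z => ∑ k, ((z k : ℤ) - a k) ^ 2 ≤ n).card ≤ 6 ^ n := by
  have h : (((Fintype.piFinset fun _ : Fin n => Finset.range (m + 1)).filter
      fun z => ∑ k, ((z k : ℤ) - a k) ^ 2 ≤ n).card : ℝ) ≤ 6 ^ n := by
    calc _ = ∑ z ∈ (Fintype.piFinset fun _ : Fin n => Finset.range (m + 1)).filter
          (fun z => ∑ k, ((z k : ℤ) - a k) ^ 2 ≤ n), (1 : ℝ) := by simp
      -- Exponential weights: for integers `|t| ≤ t²`, so the ball has `ℓ¹` radius at most `n` and
      -- every weight on it is at least 1. The weights then factor over the coordinates, which gives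
      -- `(2 * 3) ^ n`.
      _ ≤ ∑ z ∈ (Fintype.piFinset fun _ : Fin n => Finset.range (m + 1)).filter
          (fun z => ∑ k, ((z k : ℤ) - a k) ^ 2 ≤ n),
          2 ^ n * ∏ k, (1 / 2 : ℝ) ^ ((z k : ℤ) - a k).natAbs := by
        refine Finset.sum_le_sum fun z hz => ?_
        have hz := (Finset.mem_filter.1 hz).2
        have hle : ∑ k, ((z k : ℤ) - a k).natAbs ≤ n := by
          zify
          refine (Finset.sum_le_sum fun k _ => ?_).trans hz
          rw [← sq_abs]
          exact Int.le_self_sq _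
        rw [Finset.prod_pow_eq_pow_sum]
        calc (1 : ℝ) = 2 ^ n * (1 / 2) ^ n := by rw [← mul_pow]; norm_num
          _ ≤ _ := by
            gcongr 2 ^ n * ?_
            exact pow_le_pow_of_le_one (by norm_num) (by norm_num) hle
      _ ≤ ∑ z ∈ Fintype.piFinset fun _ : Fin n => Finset.range (m + 1),
          2 ^ n * ∏ k, (1 / 2 : ℝ) ^ ((z k : ℤ) - a k).natAbs :=
        Finset.sum_le_sum_of_subset_of_nonneg (Finset.filter_subset _ _)
          fun _ _ _ => by positivity
      _ = 2 ^ n * ∏ k : Fin n, ∑ j ∈ Finset.range (m + 1),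
          (1 / 2 : ℝ) ^ ((j : ℤ) - a k).natAbs := by
        rw [← Finset.mul_sum, Finset.prod_univ_sum]
      _ ≤ 2 ^ n * ∏ k : Fin n, (3 : ℝ) := by
        gcongr with k
        exact sum_range_half_pow_natAbs_le _ _
      _ = 6 ^ n := by simp [← mul_pow]; norm_num
  exact_mod_cast h

/-- A large subset of the grid `{0, …, m}ⁿ` with pairwise squared distances at least `n`. -/
lemma exists_grid_packing (n m : ℕ) : ∃ A : Finset (Fin n → ℕ), (∀ z ∈ A, ∀ k, z k ≤ m) ∧
    (∀ z ∈ A, ∀ z' ∈ A, z ≠ z' → (n : ℤ) ≤ ∑ k, ((z k : ℤ) - z' k) ^ 2) ∧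
    (m + 1) ^ n ≤ 6 ^ n * A.card := by
  classical
  let G : Finset (Fin n → ℕ) := Fintype.piFinset fun _ : Fin n => Finset.range (m + 1)
  let F : Finset (Finset (Fin n → ℕ)) := G.powerset.filter fun A =>
    ∀ z ∈ A, ∀ z' ∈ A, z ≠ z' → (n : ℤ) ≤ ∑ k, ((z k : ℤ) - z' k) ^ 2
  obtain ⟨A, hA, hmax⟩ := F.exists_max_image Finset.card ⟨∅, by simp [F]⟩
  obtain ⟨hAG, hsep⟩ := Finset.mem_filter.1 hA
  rw [Finset.mem_powerset] at hAG
  refine ⟨A, fun z hz k => ?_, hsep, ?_⟩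
  · have := Fintype.mem_piFinset.1 (hAG hz) k
    simp at this
    omega
  -- A separated set of maximal size is also a covering: an uncovered point could be added to it.
  have hcover : G ⊆ A.biUnion fun a => G.filter fun z => ∑ k, ((z k : ℤ) - a k) ^ 2 ≤ n := by
    intro z hz
    simp only [Finset.mem_biUnion, Finset.mem_filter]
    by_contra! hcon
    have hzA : z ∉ A := fun h => by simpa using (hcon z h hz).trans_le' (Nat.cast_nonneg n)
    have hins : insert z A ∈ F := by
      refine Finset.mem_filter.2 ⟨Finset.mem_powerset.2 (Finset.insert_subset hz hAG), ?_⟩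
      intro x hx x' hx' hne
      rcases Finset.mem_insert.1 hx with rfl | hxA <;>
        rcases Finset.mem_insert.1 hx' with rfl | hxA'
      · exact absurd rfl hne
      · exact (hcon x' hxA' hz).le
      · refine (hcon x hxA hz).le.trans (le_of_eq (Finset.sum_congr rfl fun k _ => by ring))
      · exact hsep x hxA x' hxA' hne
    have := hmax _ hins
    rw [Finset.card_insert_of_notMem hzA] at this
    omega
  have hG : G.card = (m + 1) ^ n := by simp [G]
  rw [← hG, mul_comm]
  exact (Finset.card_le_card hcover).trans
    (Finset.card_biUnion_le_card_mul _ _ _ fun a _ => card_grid_ball_le n m a)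

/-- Pigeonhole: many of the tuples of words have the same Gram matrix. -/
lemma exists_subset_piFinset_gram_eq {L n m : ℕ} (A : Fin L → Finset (Fin n → ℕ))
    (hA : ∀ l, ∀ z ∈ A l, ∀ k, z k ≤ m) :
    ∃ S ⊆ Fintype.piFinset A,
      (∀ z ∈ S, ∀ z' ∈ S, ∀ i j, ∑ k, z i k * z j k = ∑ k, z' i k * z' j k) ∧
      ∏ l, (A l).card ≤ (n * m ^ 2 + 1) ^ (L ^ 2) * S.card := by
  classical
  let g : (Fin L → Fin n → ℕ) → (Fin L × Fin L → ℕ) := fun z p => ∑ k, z p.1 k * z p.2 k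
  let T : Finset (Fin L × Fin L → ℕ) := Fintype.piFinset fun _ => Finset.range (n * m ^ 2 + 1)
  have hT : T.card = (n * m ^ 2 + 1) ^ (L ^ 2) := by simp [T, sq]
  have hmaps : ∀ z ∈ Fintype.piFinset A, g z ∈ T := by
    intro z hz
    rw [Fintype.mem_piFinset] at hz
    refine Fintype.mem_piFinset.2 fun p => ?_
    rw [Finset.mem_range, Nat.lt_succ_iff]
    calc ∑ k, z p.1 k * z p.2 k ≤ ∑ k : Fin n, m * m :=
          Finset.sum_le_sum fun k _ => Nat.mul_le_mul (hA _ _ (hz _) k) (hA _ _ (hz _) k)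
      _ = n * m ^ 2 := by simp [sq]
  have hTne : T.Nonempty := Finset.card_pos.1 (by rw [hT]; positivity)
  obtain ⟨q, -, hq⟩ := Finset.exists_max_image T
    (fun q => ((Fintype.piFinset A).filter fun z => g z = q).card) hTne
  refine ⟨(Fintype.piFinset A).filter fun z => g z = q, Finset.filter_subset _ _, ?_, ?_⟩
  · intro z hz z' hz' i j
    exact congrFun ((Finset.mem_filter.1 hz).2.trans (Finset.mem_filter.1 hz').2.symm) (i, j)
  · rw [← Fintype.card_piFinset, ← hT, ← smul_eq_mul]
    rw [Finset.card_eq_sum_card_fiberwise hmaps]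
    exact Finset.sum_le_card_nsmul _ _ _ hq

/-! ### The layered code and its size -/

/-- Two words on the same spheres, seen through the first layer in which they differ. -/
lemma sum_mul_sub_le_of_gram_eq {L n : ℕ} {z z' : Fin L → Fin n → ℕ} {s M : Fin L → ℝ}
    (hs : ∀ l, 0 ≤ s l) (hM : ∀ l k, (z' l k : ℝ) ≤ M l)
    (hgram : ∀ i j, ∑ k, z i k * z j k = ∑ k, z' i k * z' j k) {l : Fin L}
    (hlt : ∀ i < l, z i = z' i) (hsep : (n : ℤ) ≤ ∑ k, ((z l k : ℤ) - z' l k) ^ 2)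
    (hfine : ∑ i ∈ Finset.Ioi l, s i * M i ≤ s l / 4) :
    ∑ k, (z l k : ℝ) * (∑ i, s i * z' i k - ∑ i, s i * z i k) ≤ -(n * s l / 4) := by
  set D : ℝ := ∑ k, ((z l k : ℝ) - z' l k) ^ 2 with hD
  have hDn : (n : ℝ) ≤ D := by rw [hD]; exact_mod_cast hsep
  have hg : ∀ i j, ∑ k, (z i k : ℝ) * z j k = ∑ k, (z' i k : ℝ) * z' j k := by
    intro i j; exact_mod_cast hgram i j
  let c : Fin L → ℝ := fun i => ∑ k, (z l k : ℝ) * (z' i k - z i k)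
  have hsum : ∑ k, (z l k : ℝ) * (∑ i, s i * z' i k - ∑ i, s i * z i k) = ∑ i, s i * c i := by
    simp only [c, Finset.mul_sum, ← Finset.sum_sub_distrib]
    rw [Finset.sum_comm]
    exact Finset.sum_congr rfl fun i _ => Finset.sum_congr rfl fun k _ => by ring
  have hc_lt : ∀ i < l, c i = 0 := by
    intro i hi
    simp [c, hlt i hi]
  -- Both layers have the same norm, so the inner product is determined by the distance.
  have hc_eq : c l = -(D / 2) := by
    have h1 : D = ∑ k, (z l k : ℝ) * z l k - 2 * ∑ k, (z l k : ℝ) * z' l k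
        + ∑ k, (z' l k : ℝ) * z' l k := by
      rw [hD, Finset.mul_sum, ← Finset.sum_sub_distrib, ← Finset.sum_add_distrib]
      exact Finset.sum_congr rfl fun k _ => by ring
    have h2 : c l = ∑ k, (z l k : ℝ) * z' l k - ∑ k, (z l k : ℝ) * z l k := by
      rw [← Finset.sum_sub_distrib]
      exact Finset.sum_congr rfl fun k _ => by ring
    rw [h1, h2, ← hg l l]
    ring
  -- Equal mixed Gram entries move the difference from layer `i` to layer `l`. Integrality then
  -- bounds it by its square, so the error is proportional to `D` and can be absorbed in `c l`.
  have hc_gt : ∀ i, c i ≤ M i * D := by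
    intro i
    have h2 : c i = ∑ k, ((z l k : ℝ) - z' l k) * z' i k := by
      simp only [c, mul_sub, sub_mul, Finset.sum_sub_distrib, hg]
    rw [h2, hD, Finset.mul_sum]
    refine Finset.sum_le_sum fun k _ => ?_
    have h3 : (z l k : ℝ) - z' l k ≤ ((z l k : ℝ) - z' l k) ^ 2 := by
      have : (z l k : ℤ) - z' l k ≤ ((z l k : ℤ) - z' l k) ^ 2 := Int.le_self_sq _
      exact_mod_cast this
    calc ((z l k : ℝ) - z' l k) * z' i k ≤ ((z l k : ℝ) - z' l k) ^ 2 * z' i k := by gcongr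
      _ ≤ ((z l k : ℝ) - z' l k) ^ 2 * M i := by gcongr; exact hM i k
      _ = _ := mul_comm _ _
  have hD0 : 0 ≤ D := by rw [hD]; positivity
  have hsplit : ∑ i, s i * c i = s l * c l + ∑ i ∈ Finset.Ioi l, s i * c i := by
    rw [← Finset.sum_insert (f := fun i => s i * c i) (s := Finset.Ioi l) (by simp)]
    refine (Finset.sum_subset (Finset.subset_univ _) fun i _ hi => ?_).symm
    rw [hc_lt i (by simpa using hi), mul_zero]
  have htail : ∑ i ∈ Finset.Ioi l, s i * c i ≤ s l / 4 * D := by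
    calc ∑ i ∈ Finset.Ioi l, s i * c i ≤ ∑ i ∈ Finset.Ioi l, s i * M i * D := by
          refine Finset.sum_le_sum fun i _ => ?_
          rw [mul_assoc]
          exact mul_le_mul_of_nonneg_left (hc_gt i) (hs i)
      _ = (∑ i ∈ Finset.Ioi l, s i * M i) * D := by rw [Finset.sum_mul]
      _ ≤ _ := by gcongr
  rw [hsum, hsplit, hc_eq]
  have := mul_le_mul_of_nonneg_left hDn (hs l)
  nlinarith

lemma exp_neg_two_mul_le_two_rpow {x : ℝ} (hx : 0 ≤ x) : Real.exp (-(2 * x)) ≤ (2 : ℝ) ^ (-x) := by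
  rw [Real.rpow_def_of_pos two_pos]
  have := Real.log_two_lt_d9
  have := Real.log_two_gt_d9
  exact Real.exp_le_exp.2 (by nlinarith)

/-- The layered code: words built from layers of decreasing amplitude, on common spheres, are
identified by one linear test for each layer. -/
lemma existsDICode_of_layers {X Y : Type*} [Countable Y] [MeasurableSpace Y]
    [DiscreteMeasurableSpace Y] {W : X → PMF Y} {y₀ : Y} {a b : ℝ}
    (hW : ∀ p ∈ Set.Icc a b, ∃ x, (W x y₀).toReal = p) {L n : ℕ} (hn : 0 < n) {E : ℝ} (hE : 0 < E)
    {s M : Fin L → ℝ} (hs : ∀ l, 0 ≤ s l) (hM : ∀ l, 0 < M l)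
    (hL : 0 < L) (hrange : ∑ l, s l * M l ≤ b - a)
    (hfine : ∀ l, ∑ i ∈ Finset.Ioi l, s i * M i ≤ s l / 4)
    (hnoise : ∀ l, 8 * M l * √E ≤ s l)
    (S : Finset (Fin L → Fin n → ℕ)) (hSM : ∀ z ∈ S, ∀ l k, (z l k : ℝ) ≤ M l)
    (hgram : ∀ z ∈ S, ∀ z' ∈ S, ∀ i j, ∑ k, z i k * z j k = ∑ k, z' i k * z' j k)
    (hsep : ∀ z ∈ S, ∀ z' ∈ S, ∀ l, z l ≠ z' l → (n : ℤ) ≤ ∑ k, ((z l k : ℤ) - z' l k) ^ 2) :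
    ExistsDICode W n S.card (L * (2 : ℝ) ^ (-(n * E))) ((2 : ℝ) ^ (-(n * E))) := by
  classical
  let u : (Fin L → Fin n → ℕ) → Fin n → ℝ := fun z k => a + ∑ l, s l * z l k
  have hu : ∀ z ∈ S, ∀ k, ∃ x, (W x y₀).toReal = u z k := by
    intro z hz k
    refine hW _ ⟨?_, ?_⟩
    · have : 0 ≤ ∑ l, s l * (z l k : ℝ) :=
        Finset.sum_nonneg fun l _ => mul_nonneg (hs l) (Nat.cast_nonneg _)
      simp only [u]; linarith
    · have : ∑ l, s l * (z l k : ℝ) ≤ ∑ l, s l * M l :=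
        Finset.sum_le_sum fun l _ => mul_le_mul_of_nonneg_left (hSM z hz l k) (hs l)
      simp only [u]; linarith
  have hab : a ≤ b := by
    have : 0 ≤ ∑ l, s l * M l := Finset.sum_nonneg fun l _ => mul_nonneg (hs l) (hM l).le
    linarith
  have : Nonempty X := ⟨(hW a ⟨le_rfl, hab⟩).choose⟩
  choose! x hx using hu
  let e : Fin S.card ≃ S := S.equivFin.symm
  let B : Y → ℝ := Set.indicator {y₀} 1
  let T : (Fin L → Fin n → ℕ) → Fin L → (Fin n → Y) → ℝ := fun z l y =>
    ∑ k, (z l k : ℝ) * (B (y k) - u z k)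
  -- With this threshold Hoeffding's bound is exactly `exp (-2nE)`.
  let t : Fin L → ℝ := fun l => M l * n * √E
  have ht : ∀ l, 0 ≤ t l := fun l => by have := (hM l).le; positivity
  have hexp : ∀ l, Real.exp (-(2 * t l ^ 2) / (n * M l ^ 2)) ≤ (2 : ℝ) ^ (-(n * E)) := by
    intro l
    have hMl := hM l
    have hn' : (0 : ℝ) < n := by exact_mod_cast hn
    refine (le_of_eq ?_).trans (exp_neg_two_mul_le_two_rpow (x := n * E) (by positivity))
    congr 1
    simp only [t, mul_pow, Real.sq_sqrt hE.le]
    field_simp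
  have habs : ∀ z ∈ S, ∀ l k, |(z l k : ℝ)| ≤ M l := fun z hz l k => by
    rw [abs_of_nonneg (Nat.cast_nonneg _)]; exact hSM z hz l k
  have htail : ∀ z ∈ S, ∀ v ∈ S, ∀ l,
      (Measure.pi fun k => (W (x v k)).toMeasure).real
        {y | t l ≤ ∑ k, (z l k : ℝ) * (B (y k) - u v k)} ≤ (2 : ℝ) ^ (-(n * E)) := by
    intro z hz v hv l
    refine le_trans ?_ (hexp l)
    have := measureReal_weighted_count_ge_le (fun k => W (x v k)) y₀ (fun k => (z l k : ℝ))
      (habs z hz l) (ht l)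
    simpa only [hx v hv] using this
  have htail' : ∀ z ∈ S, ∀ l, (Measure.pi fun k => (W (x z k)).toMeasure).real
        {y | T z l y ≤ -t l} ≤ (2 : ℝ) ^ (-(n * E)) := by
    intro z hz l
    refine le_trans ?_ (hexp l)
    have := measureReal_weighted_count_ge_le (fun k => W (x z k)) y₀ (fun k => -(z l k : ℝ))
      (fun k => (abs_neg _).trans_le (habs z hz l k)) (ht l)
    simp only [hx z hz] at this
    refine (measureReal_mono fun y hy => ?_).trans this
    simp only [Set.mem_ofPred_eq, T, B, neg_mul, Finset.sum_neg_distrib] at hy ⊢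
    linarith
  refine ⟨fun i => x (e i), fun i => {y | ∀ l, -t l < T (e i) l y}, ?_, by positivity, ?_, ?_⟩
  · have : (0 : ℝ) < L := by exact_mod_cast hL
    positivity
  · intro i
    set z : Fin L → Fin n → ℕ := (e i).1 with hz_def
    have hz : z ∈ S := (e i).2
    set μ := Measure.pi fun k => (W (x z k)).toMeasure with hμ
    have hcompl : {y | ∀ l, -t l < T z l y}ᶜ ⊆ ⋃ l, {y | T z l y ≤ -t l} := by
      intro y hy
      simpa using hy
    have h1 : μ.real {y | ∀ l, -t l < T z l y}ᶜ ≤ L * (2 : ℝ) ^ (-(n * E)) := by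
      calc _ ≤ μ.real (⋃ l, {y | T z l y ≤ -t l}) := measureReal_mono hcompl
        _ ≤ ∑ l, μ.real {y | T z l y ≤ -t l} := measureReal_iUnion_fintype_le _
        _ ≤ ∑ l : Fin L, (2 : ℝ) ^ (-(n * E)) := Finset.sum_le_sum fun l _ => htail' z hz l
        _ = _ := by simp
    rw [probReal_compl_eq_one_sub MeasurableSet.of_discrete] at h1
    linarith
  · intro i j hij
    set z : Fin L → Fin n → ℕ := (e j).1 with hz_def
    set v : Fin L → Fin n → ℕ := (e i).1 with hv_def
    have hz : z ∈ S := (e j).2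
    have hv : v ∈ S := (e i).2
    have hne : z ≠ v := fun h => hij (e.injective (Subtype.ext h.symm))
    obtain ⟨l, hl, hmin⟩ : ∃ l, z l ≠ v l ∧ ∀ i < l, z i = v i := by
      have hne' : (Finset.univ.filter fun l => z l ≠ v l).Nonempty := by
        obtain ⟨l, hl⟩ := Function.ne_iff.1 hne
        exact ⟨l, by simpa using hl⟩
      refine ⟨Finset.min' _ hne', ?_, fun i hi => ?_⟩
      · simpa using Finset.min'_mem _ hne'
      · by_contra h
        exact absurd (Finset.min'_le _ i (by simpa using h)) (not_le.2 hi)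
    -- Under `v` the test statistic of `z` has mean at most `-n * s l / 4 ≤ -2 * t l`, so acceptance
    -- requires an upward deviation of at least `t l`.
    refine le_trans (measureReal_mono ?_) (htail z hz v hv l)
    intro y hy
    have h1 : -t l < T z l y := hy l
    have h2 := sum_mul_sub_le_of_gram_eq hs (hSM v hv) (hgram z hz v hv) hmin
      (hsep z hz v hv l hl) (hfine l)
    have h3 : T z l y = ∑ k, (z l k : ℝ) * (B (y k) - u v k) +
        ∑ k, (z l k : ℝ) * (∑ i, s i * v i k - ∑ i, s i * z i k) := by
      rw [← Finset.sum_add_distrib]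
      exact Finset.sum_congr rfl fun k _ => by simp only [u]; ring
    have h4 : 2 * t l ≤ n * s l / 4 := by
      have := mul_le_mul_of_nonneg_left (hnoise l) (Nat.cast_nonneg (α := ℝ) n)
      simp only [t]
      linarith
    simp only [Set.mem_ofPred_eq]
    linarith

/-- The amplitudes of the layers decrease like `ρ ^ (2⁻ˡ)`, which gives a code whose size is
`ρ ^ (n (1 - η(L)))` up to factors of lower order. -/
lemma exists_layered_code {X Y : Type*} [Countable Y] [MeasurableSpace Y]
    [DiscreteMeasurableSpace Y] {W : X → PMF Y} {y₀ : Y} {a b : ℝ}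
    (hW : ∀ p ∈ Set.Icc a b, ∃ x, (W x y₀).toReal = p) {L n : ℕ} (hL : 0 < L) (hn : 0 < n)
    {E ρ : ℝ} (hE : 0 < E) (hρ : ρ = 2 * L * (b - a) / √E) (hρ1 : 1 ≤ ρ) :
    ∃ N : ℕ, 1 ≤ N ∧ ExistsDICode W n N (L * (2 : ℝ) ^ (-(n * E))) ((2 : ℝ) ^ (-(n * E))) ∧
      (ρ ^ (1 - layerLoss L)) ^ n ≤ ((24 * L : ℝ) ^ L) ^ n * (n * ρ ^ 2 + 1) ^ (L ^ 2) * N := by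
  have hρ0 : 0 < ρ := by linarith
  have hLr : (0 : ℝ) < L := by exact_mod_cast hL
  have hε : 0 < √E := Real.sqrt_pos.2 hE
  let r : ℕ → ℝ := fun l => ρ ^ ((1 / 2 : ℝ) ^ l)
  let κ : ℝ := √E / (2 * L ^ 2)
  have hκ : 0 < κ := by positivity
  have hr0 : ∀ l, 0 < r l := fun l => Real.rpow_pos_of_pos hρ0 _
  have hrsq : ∀ l, r (l + 1) * r (l + 1) = r l := fun l => by
    simp only [r]
    rw [← Real.rpow_add hρ0]
    congr 1
    rw [pow_succ]; ring
  have hanti : ∀ i j, i ≤ j → r j ≤ r i := fun i j hij =>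
    Real.rpow_le_rpow_of_exponent_le hρ1 (pow_le_pow_of_le_one (by norm_num) (by norm_num) hij)
  have hrz : r 0 = ρ := by simp [r]
  -- The noise condition holds with equality, and `s l * M l = κ * r l`, where `r l = r (l + 1) ^
  -- 2`. Thus the amplitude of layer `l + 1` is comparable to the spacing `s l`, while `∏ M l` is `ρ
  -- ^ (1/2 + ⋯ + 2⁻ᴸ)` up to the factor `(4L) ^ L`. The value of `κ` makes the amplitudes fit into
  -- `b - a`.
  let M : Fin L → ℝ := fun l => r (l + 1) / (4 * L)
  let s : Fin L → ℝ := fun l => 4 * L * κ * r (l + 1)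
  have hM : ∀ l, 0 < M l := fun l => div_pos (hr0 _) (by positivity)
  have hs : ∀ l, 0 ≤ s l := fun l => mul_nonneg (by positivity) (hr0 _).le
  have hsM : ∀ l, s l * M l = κ * r l := fun l => by
    rw [← hrsq l]
    simp only [s, M]
    field_simp
  have hLone : (1 : ℝ) ≤ L := by exact_mod_cast hL
  have hMρ : ∀ l, M l ≤ ρ := fun l => by
    refine (div_le_self (hr0 _).le (by linarith)).trans ?_
    rw [← hrz]
    exact hanti _ _ (Nat.zero_le _)
  let m : Fin L → ℕ := fun l => ⌊M l⌋₊
  have hm : ∀ l, m l ≤ ⌊ρ⌋₊ := fun l => Nat.floor_mono (hMρ l)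
  choose A hA1 hA2 hA3 using fun l => exists_grid_packing n (m l)
  obtain ⟨S, hSA, hgram, hcard⟩ := exists_subset_piFinset_gram_eq A
    (fun l z hz k => (hA1 l z hz k).trans (hm l))
  have hsize : (ρ ^ (1 - layerLoss L)) ^ n ≤
      ((24 * L : ℝ) ^ L) ^ n * (n * ρ ^ 2 + 1) ^ (L ^ 2) * S.card := by
    have h1 : ρ ^ (1 - layerLoss L) = (4 * L : ℝ) ^ L * ∏ l, M l := by
      have h2 : ∏ l, M l = (∏ l : Fin L, r (l + 1)) / (4 * L) ^ L := by
        simp [M, Finset.prod_div_distrib]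
      rw [h2, mul_div_cancel₀ _ (by positivity), Fin.prod_univ_eq_prod_range (fun l => r (l + 1)) L]
      simp only [r, layerLoss, sub_sub_cancel]
      rw [Real.rpow_sum_of_pos hρ0, Finset.range_eq_Ico,
        Finset.prod_Ico_add' (fun l => ρ ^ ((1 / 2 : ℝ) ^ l)) 0 L 1]
      rfl
    have h3 : (∏ l, M l) ^ n ≤ ∏ l, (6 ^ n * ((A l).card : ℝ)) := by
      rw [← Finset.prod_pow]
      refine Finset.prod_le_prod (fun l _ => pow_nonneg (hM l).le _) fun l _ => ?_
      calc M l ^ n ≤ ((m l : ℝ) + 1) ^ n :=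
            pow_le_pow_left₀ (hM l).le (Nat.lt_floor_add_one _).le _
        _ ≤ _ := by exact_mod_cast hA3 l
    have h4 : ∏ l, ((A l).card : ℝ) ≤ (n * ρ ^ 2 + 1) ^ (L ^ 2) * S.card := by
      have h5 : ∏ l, ((A l).card : ℝ) ≤ (n * (⌊ρ⌋₊ : ℝ) ^ 2 + 1) ^ (L ^ 2) * S.card := by
        exact_mod_cast hcard
      refine h5.trans ?_
      gcongr
      exact Nat.floor_le hρ0.le
    rw [h1, mul_pow]
    calc ((4 * L : ℝ) ^ L) ^ n * (∏ l, M l) ^ n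
        ≤ ((4 * L : ℝ) ^ L) ^ n * ((6 ^ n) ^ L * ((n * ρ ^ 2 + 1) ^ (L ^ 2) * S.card)) := by
          gcongr
          refine h3.trans ?_
          rw [Finset.prod_mul_distrib]
          simp only [Finset.prod_const, Finset.card_univ, Fintype.card_fin]
          gcongr
      _ = _ := by
          rw [show (24 * L : ℝ) = 6 * (4 * L) by ring, mul_pow 6 (4 * L : ℝ),
            mul_pow (6 ^ L : ℝ), pow_right_comm]
          ring
  refine ⟨S.card, ?_, ?_, hsize⟩
  · by_contra h
    have h0 : S.card = 0 := by omega
    rw [h0] at hsize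
    have : 0 < (ρ ^ (1 - layerLoss L)) ^ n := by positivity
    simp at hsize
    linarith
  · refine existsDICode_of_layers hW hn hE hs hM hL ?_ ?_ ?_ S ?_ hgram ?_
    · calc ∑ l, s l * M l ≤ ∑ l : Fin L, κ * ρ := by
            refine Finset.sum_le_sum fun l _ => ?_
            rw [hsM, ← hrz]
            exact mul_le_mul_of_nonneg_left (hanti _ _ (Nat.zero_le _)) hκ.le
        _ = b - a := by
            simp only [Finset.sum_const, Finset.card_univ, Fintype.card_fin, nsmul_eq_mul, κ, hρ]
            field_simp
    · intro l
      calc ∑ i ∈ Finset.Ioi l, s i * M i ≤ ∑ i ∈ Finset.Ioi l, κ * r (l + 1) := by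
            refine Finset.sum_le_sum fun i hi => ?_
            rw [hsM]
            exact mul_le_mul_of_nonneg_left (hanti _ _ (Finset.mem_Ioi.1 hi)) hκ.le
        _ ≤ ∑ i : Fin L, κ * r (l + 1) :=
            Finset.sum_le_sum_of_subset_of_nonneg (Finset.subset_univ _)
              fun _ _ _ => mul_nonneg hκ.le (hr0 _).le
        _ = s l / 4 := by
            simp only [Finset.sum_const, Finset.card_univ, Fintype.card_fin, nsmul_eq_mul, s]
            ring
    · intro l
      simp only [s, M, κ]
      refine le_of_eq ?_
      field_simp
      ring
    · intro z hz l k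
      have h1 : z l k ≤ m l := hA1 l _ (Fintype.mem_piFinset.1 (hSA hz) l) k
      calc (z l k : ℝ) ≤ m l := by exact_mod_cast h1
        _ ≤ M l := Nat.floor_le (hM l).le
    · intro z hz z' hz' l hne
      exact hA2 l _ (Fintype.mem_piFinset.1 (hSA hz) l) _ (Fintype.mem_piFinset.1 (hSA hz') l) hne

/-! ### Rates for all block lengths and exponents -/

/-- When the required error probabilities exceed those of a fixed biased coin, all messages may
share one word and one region. -/
lemma existsDICode_of_le_rpow {X Y : Type*} [Countable Y] [MeasurableSpace Y]
    [DiscreteMeasurableSpace Y] {W : X → PMF Y} {y₀ : Y} (x : X) {n N L : ℕ} (hn : 0 < n)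
    (hL : 0 < L) {p : ℝ} (hp : 0 < p) (h₁ : (W x y₀).toReal ≤ p) (h₂ : 1 - (W x y₀).toReal ≤ p) :
    ExistsDICode W n N (L * p) p := by
  have hLr : (1 : ℝ) ≤ L := by exact_mod_cast hL
  have hprob : (Measure.pi fun _ : Fin n => (W x).toMeasure).real {y | y ⟨0, hn⟩ = y₀} =
      (W x y₀).toReal := by
    have h := (measurePreserving_eval (fun _ : Fin n => (W x).toMeasure)
      ⟨0, hn⟩).measureReal_preimage (MeasurableSet.of_discrete (s := ({y₀} : Set Y))).nullMeasurableSet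
    refine Eq.trans h ?_
    simp [Measure.real, PMF.toMeasure_apply_singleton]
  refine ⟨fun _ _ => x, fun _ => {y | y ⟨0, hn⟩ = y₀}, by positivity, hp, fun i => ?_,
    fun i j _ => ?_⟩
  · rw [hprob]; nlinarith
  · rw [hprob]; exact h₁

lemma existsDICode_one {X Y : Type*} [Countable Y] [MeasurableSpace Y]
    [DiscreteMeasurableSpace Y] {W : X → PMF Y} (x : X) (n : ℕ) {lam₁ lam₂ : ℝ} (h₁ : 0 < lam₁)
    (h₂ : 0 < lam₂) : ExistsDICode W n 1 lam₁ lam₂ := by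
  refine ⟨fun _ _ => x, fun _ => Set.univ, h₁, h₂, fun i => ?_,
    fun i j hij => absurd (Subsingleton.elim i j) hij⟩
  simp [h₁.le]

lemma layerLoss_le_one (L : ℕ) : layerLoss L ≤ 1 := by
  rw [layerLoss_eq]
  exact pow_le_one₀ (by norm_num) (by norm_num)

/-- The rate of a layered code, when the exponent is not too small. -/
lemma linearRate_ge_of_size {L n N : ℕ} (hL : 0 < L) (hn : 0 < n) (hN : 0 < N) {E ρ h c : ℝ}
    (hE : 0 < E) (hh0 : 0 < h) (hc0 : 0 < c) (hcoin : c < n * E) (hρ : ρ = 2 * L * h / √E)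
    (hsize : (ρ ^ (1 - layerLoss L)) ^ n ≤
      ((24 * L : ℝ) ^ L) ^ n * (n * ρ ^ 2 + 1) ^ (L ^ 2) * N) :
    (1 - layerLoss L) / 2 * Real.logb 2 (1 / E) - (L * Real.logb 2 (24 * L) +
      L ^ 2 * (2 + Real.logb 2 (4 * L ^ 2 * h ^ 2 / c + 1)) + |Real.logb 2 (2 * L * h)|) ≤
      linearRate n N := by
  have hLr : (0 : ℝ) < L := by exact_mod_cast hL
  have hn' : (0 : ℝ) < n := by exact_mod_cast hn
  have hsq : 0 < √E := Real.sqrt_pos.2 hE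
  set θ := 1 - layerLoss L with hθ
  have hθ0 : 0 ≤ θ := by have := layerLoss_le_one L; linarith
  have hθ1 : θ ≤ 1 := by have := layerLoss_pos L; linarith
  have hρ0 : 0 < ρ := by rw [hρ]; positivity
  have hNr : (0 : ℝ) < N := by exact_mod_cast hN
  have hK₁0 : 0 ≤ Real.logb 2 (4 * L ^ 2 * h ^ 2 / c + 1) := Real.logb_nonneg one_lt_two (by
    have : 0 ≤ 4 * L ^ 2 * h ^ 2 / c := by positivity
    linarith)
  have hlog := Real.logb_le_logb_of_le one_lt_two (by positivity) hsize
  rw [Real.logb_mul (by positivity) hNr.ne', Real.logb_mul (by positivity) (by positivity),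
    Real.logb_pow, Real.logb_pow, Real.logb_pow, Real.logb_pow,
    Real.logb_rpow_eq_mul_logb_of_pos hρ0] at hlog
  have hρlog : Real.logb 2 ρ = Real.logb 2 (2 * L * h) + Real.logb 2 (1 / E) / 2 := by
    rw [hρ, Real.logb_div (by positivity) hsq.ne', one_div, Real.logb_inv, Real.sqrt_eq_rpow,
      Real.logb_rpow_eq_mul_logb_of_pos hE]
    ring
  set K₁ := Real.logb 2 (4 * L ^ 2 * h ^ 2 / c + 1) with hK₁
  set K₂ := L * Real.logb 2 (24 * L) with hK₂
  set K₃ := |Real.logb 2 (2 * L * h)| with hK₃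
  -- Since `1 / E < n / c`, the number of Gram matrices is polynomial in `n` and costs only a
  -- constant in the rate.
  have hpoly : Real.logb 2 (n * ρ ^ 2 + 1) ≤ n * (2 + K₁) := by
    have hn1 : (1 : ℝ) ≤ n := by exact_mod_cast hn
    have h1 : n * ρ ^ 2 + 1 ≤ n ^ 2 * (4 * L ^ 2 * h ^ 2 / c + 1) := by
      have h2 : ρ ^ 2 = 4 * L ^ 2 * h ^ 2 / E := by
        rw [hρ, div_pow, Real.sq_sqrt hE.le]
        ring
      have h3 : 4 * L ^ 2 * h ^ 2 / E ≤ n * (4 * L ^ 2 * h ^ 2 / c) := by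
        rw [div_le_iff₀ hE, mul_div_assoc', div_mul_eq_mul_div, le_div_iff₀ hc0]
        have : 0 ≤ 4 * L ^ 2 * h ^ 2 := by positivity
        nlinarith
      rw [h2]
      nlinarith
    have h4 := Real.logb_le_logb_of_le one_lt_two (by positivity) h1
    rw [Real.logb_mul (by positivity) (by positivity), Real.logb_pow] at h4
    have h5 : Real.logb 2 n ≤ n := by
      rw [Real.logb_le_iff_le_rpow one_lt_two hn', Real.rpow_natCast]
      exact_mod_cast Nat.lt_two_pow_self.le
    push_cast at h4
    nlinarith
  have h6 : -K₃ ≤ θ * Real.logb 2 (2 * L * h) := by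
    have h7 := neg_abs_le (Real.logb 2 (2 * L * h))
    rw [← hK₃] at h7
    have hK₃0 : 0 ≤ K₃ := abs_nonneg _
    have := mul_le_mul_of_nonneg_left h7 hθ0
    nlinarith
  have h8 : n * (θ / 2 * Real.logb 2 (1 / E) - (K₂ + L ^ 2 * (2 + K₁) + K₃)) ≤
      Real.logb 2 N := by
    rw [hρlog] at hlog
    push_cast at hlog
    have h9 := mul_le_mul_of_nonneg_left hpoly (sq_nonneg (L : ℝ))
    have h10 := mul_le_mul_of_nonneg_left h6 hn'.le
    linarith
  rw [linearRate, le_div_iff₀ hn']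
  linarith

/-- Achievability: the rate `(1 - η(L)) / 2 · log (1 / E)` up to a constant. -/
lemma exists_code_linearRate_ge {X Y : Type*} [Countable Y] [MeasurableSpace Y]
    [DiscreteMeasurableSpace Y] {W : X → PMF Y} (hW : BernoulliReducible W) {L : ℕ} (hL : 0 < L) :
    ∃ C : ℝ, ∀ n : ℕ, 0 < n → ∀ E : ℝ, 0 < E → ∃ N : ℕ, 1 ≤ N ∧
      ExistsDICode W n N (L * (2 : ℝ) ^ (-(n * E))) ((2 : ℝ) ^ (-(n * E))) ∧
      (1 - layerLoss L) / 2 * Real.logb 2 (1 / E) - C ≤ linearRate n N := by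
  obtain ⟨y₀, a, b, ha, hab, hb, hx⟩ := hW.exists_Icc_subset
  have hLr : (0 : ℝ) < L := by exact_mod_cast hL
  obtain ⟨x, hx0⟩ := hx ((a + b) / 2) ⟨by linarith, by linarith⟩
  set h := b - a with hh
  have hh0 : 0 < h := by linarith
  have hh1 : h ≤ 1 := by linarith
  set q := max ((a + b) / 2) (1 - (a + b) / 2) with hq
  have hq0 : 0 < q := lt_max_of_lt_left (by linarith)
  have hq1 : q < 1 := max_lt (by linarith) (by linarith)
  set c := -Real.logb 2 q with hc
  have hc0 : 0 < c := by
    have := Real.logb_neg one_lt_two hq0 hq1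
    linarith
  set θ := 1 - layerLoss L with hθ
  have hθ0 : 0 ≤ θ := by have := layerLoss_le_one L; linarith
  have hθ1 : θ ≤ 1 := by have := layerLoss_pos L; linarith
  set K₀ := Real.logb 2 (1 / h ^ 2) with hK₀
  have hK₀0 : 0 ≤ K₀ := Real.logb_nonneg one_lt_two (by
    rw [le_div_iff₀ (by positivity)]; nlinarith)
  set K₁ := Real.logb 2 (4 * L ^ 2 * h ^ 2 / c + 1) with hK₁
  have hK₁0 : 0 ≤ K₁ := Real.logb_nonneg one_lt_two (by
    have : 0 ≤ 4 * L ^ 2 * h ^ 2 / c := by positivity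
    linarith)
  set K₂ := L * Real.logb 2 (24 * L) with hK₂
  have hK₂0 : 0 ≤ K₂ := mul_nonneg hLr.le (Real.logb_nonneg one_lt_two (by
    have : (1 : ℝ) ≤ L := by exact_mod_cast hL
    linarith))
  set K₃ := |Real.logb 2 (2 * L * h)| with hK₃
  have hK₃0 : 0 ≤ K₃ := abs_nonneg _
  refine ⟨K₀ + (K₂ + L ^ 2 * (2 + K₁) + K₃), fun n hn E hE => ?_⟩
  have hn' : (0 : ℝ) < n := by exact_mod_cast hn
  have hKs : 0 ≤ K₂ + L ^ 2 * (2 + K₁) + K₃ := by positivity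
  have hpow : (0 : ℝ) < (2 : ℝ) ^ (-(n * E)) := by positivity
  -- For large `E` the claimed rate is at most a constant, and one message suffices.
  rcases lt_or_ge h (√E) with hbig | hsmall
  · refine ⟨1, le_rfl, existsDICode_one x n (by positivity) hpow, ?_⟩
    have h1 : Real.logb 2 (1 / E) ≤ K₀ := by
      refine Real.logb_le_logb_of_le one_lt_two (by positivity) ?_
      refine one_div_le_one_div_of_le (by positivity) ?_
      rw [← Real.sq_sqrt hE.le]
      exact pow_le_pow_left₀ hh0.le hbig.le 2
    have h2 : θ / 2 * Real.logb 2 (1 / E) ≤ θ / 2 * K₀ := by gcongr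
    simp only [linearRate, Nat.cast_one, Real.logb_one, zero_div]
    nlinarith
  -- If `n * E ≤ c`, then `2 ^ (-(n * E)) ≥ q`, and the coin code serves any number of messages.
  -- This case is separate because the Gram cost is not uniformly bounded as `E → 0` for fixed `n`.
  rcases le_or_gt (n * E) c with hcoin | hcoin
  · set R := θ / 2 * Real.logb 2 (1 / E) with hR
    refine ⟨⌈(2 : ℝ) ^ (n * R)⌉₊, Nat.one_le_ceil_iff.2 (by positivity), ?_, ?_⟩
    · have hqp : q ≤ (2 : ℝ) ^ (-(n * E)) := by
        calc q = (2 : ℝ) ^ (-c) := by rw [hc, neg_neg, Real.rpow_logb two_pos (by norm_num) hq0]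
          _ ≤ _ := Real.rpow_le_rpow_of_exponent_le one_le_two (by linarith)
      exact existsDICode_of_le_rpow x hn hL hpow (by rw [hx0]; exact (le_max_left _ _).trans hqp)
        (by rw [hx0]; exact (le_max_right _ _).trans hqp)
    · have h1 : n * R ≤ Real.logb 2 ⌈(2 : ℝ) ^ (n * R)⌉₊ := by
        rw [Real.le_logb_iff_rpow_le one_lt_two (by
          exact_mod_cast Nat.ceil_pos.2 (by positivity))]
        exact Nat.le_ceil _
      have h2 : R ≤ linearRate n ⌈(2 : ℝ) ^ (n * R)⌉₊ := by
        rw [linearRate, le_div_iff₀ hn']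
        linarith
      linarith
  · have hsq : 0 < √E := Real.sqrt_pos.2 hE
    have hL1 : (1 : ℝ) ≤ L := by exact_mod_cast hL
    have hρ1 : 1 ≤ 2 * L * h / √E := by
      rw [le_div_iff₀ hsq]
      nlinarith
    obtain ⟨N, hN, hcode, hsize⟩ := exists_layered_code hx hL hn hE rfl hρ1
    refine ⟨N, hN, hcode, ?_⟩
    rw [← hh] at hsize
    have := linearRate_ge_of_size hL hn hN hE hh0 hc0 hcoin rfl hsize
    linarith

/-! ### Converse: Bhattacharyya coefficients and covers -/

/-- The Bhattacharyya coefficient of two distributions. -/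
noncomputable def bhattacharyya {Y : Type*} (P Q : PMF Y) : ℝ :=
  ∑' y, √((P y).toReal * (Q y).toReal)

lemma PMF.summable_toReal {Y : Type*} (P : PMF Y) : Summable fun y => (P y).toReal :=
  ENNReal.summable_toReal P.tsum_coe_ne_top

lemma PMF.tsum_toReal {Y : Type*} (P : PMF Y) : ∑' y, (P y).toReal = 1 := by
  rw [← ENNReal.tsum_toReal_eq fun y => P.apply_ne_top y, P.tsum_coe, ENNReal.toReal_one]

/-- AM-GM for `c * a` and `b / c`. The free parameter replaces Cauchy-Schwarz by a termwise bound.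
-/
lemma sqrt_mul_le_half_add {a b c : ℝ} (ha : 0 ≤ a) (hb : 0 ≤ b) (hc : 0 < c) :
    √(a * b) ≤ (c * a + b / c) / 2 := by
  refine Real.sqrt_le_iff.2 ⟨by positivity, ?_⟩
  have h : a * b = c * a * (b / c) := by field_simp
  rw [h]
  nlinarith [sq_nonneg (c * a - b / c)]

lemma summable_sqrt_mul {Y : Type*} {p q : Y → ℝ} (hp0 : ∀ y, 0 ≤ p y) (hq0 : ∀ y, 0 ≤ q y)
    (hp : Summable p) (hq : Summable q) : Summable fun y => √(p y * q y) := by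
  refine Summable.of_nonneg_of_le (fun _ => Real.sqrt_nonneg _)
    (fun y => sqrt_mul_le_half_add (hp0 y) (hq0 y) one_pos) ?_
  simpa using (hp.add hq).div_const 2

lemma dist_sqrtPMF_sq {Y : Type*} (P Q : PMF Y) :
    dist (sqrtPMF P) (sqrtPMF Q) ^ 2 = 2 - 2 * bhattacharyya P Q := by
  have hinner : ∀ P Q : PMF Y, inner ℝ (sqrtPMF P) (sqrtPMF Q) = bhattacharyya P Q := by
    intro P Q
    rw [lp.inner_eq_tsum, bhattacharyya]
    refine tsum_congr fun y => ?_
    rw [Real.sqrt_mul ENNReal.toReal_nonneg]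
    simp [sqrtPMF, mul_comm]
  have hself : ∀ P : PMF Y, ‖sqrtPMF P‖ ^ 2 = 1 := by
    intro P
    rw [← real_inner_self_eq_norm_sq, hinner, bhattacharyya, ← P.tsum_toReal]
    exact tsum_congr fun y => Real.sqrt_mul_self ENNReal.toReal_nonneg
  rw [dist_eq_norm, norm_sub_sq_real, hself, hself, hinner]
  ring

lemma pi_count_eq_count {Y : Type*} [Countable Y] [MeasurableSpace Y] [DiscreteMeasurableSpace Y]
    (n : ℕ) : Measure.pi (fun _ : Fin n => (Measure.count : Measure Y)) = Measure.count := by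
  rw [Measure.ext_iff_singleton]
  intro y
  simp [Measure.pi_singleton]

/-- A product of sums over a countable alphabet is a sum over words. -/
lemma hasSum_prod_words {Y : Type*} [Countable Y] {n : ℕ} (f : Fin n → Y → ℝ)
    (hf : ∀ k, Summable (f k)) :
    HasSum (fun y : Fin n → Y => ∏ k, f k (y k)) (∏ k, ∑' y, f k y) := by
  -- Words are summed by Fubini for the counting measure.
  let : MeasurableSpace Y := ⊤
  have hint : ∀ k, Integrable (f k) (Measure.count : Measure Y) := fun k =>
    integrable_count_iff.2 (hf k).norm
  have hI := Integrable.fintype_prod (μ := fun _ : Fin n => (Measure.count : Measure Y)) hint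
  have heq := integral_fintype_prod_eq_prod (μ := fun _ : Fin n => (Measure.count : Measure Y)) f
  rw [pi_count_eq_count] at hI heq
  have hs : Summable fun y : Fin n → Y => ∏ k, f k (y k) := (integrable_count_iff.1 hI).of_norm
  rw [integral_countable hI] at heq
  simp only [integral_countable (hint _)] at heq
  simp only [Measure.real, Measure.count_singleton, ENNReal.toReal_one, one_smul] at heq
  rw [← heq]
  exact hs.hasSum

lemma hasSum_indicator_measureReal_pi {Y : Type*} [Countable Y] [MeasurableSpace Y]
    [DiscreteMeasurableSpace Y] {n : ℕ} (P : Fin n → PMF Y) (D : Set (Fin n → Y)) :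
    HasSum (D.indicator fun y => ∏ k, (P k (y k)).toReal)
      ((Measure.pi fun k => (P k).toMeasure).real D) := by
  set μ := Measure.pi fun k => (P k).toMeasure with hμ
  have hs : Summable fun y : Fin n → Y => ∏ k, (P k (y k)).toReal :=
    (hasSum_prod_words (fun k y => (P k y).toReal) fun k => (P k).summable_toReal).summable
  have hpt : ∀ y, μ.real {y} = ∏ k, (P k (y k)).toReal := by
    intro y
    simp [Measure.real, hμ, Measure.pi_singleton, PMF.toMeasure_apply_singleton,
      ENNReal.toReal_prod]
  have h := integral_countable (μ := μ) (f := D.indicator (1 : (Fin n → Y) → ℝ))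
    ((integrable_const (1 : ℝ)).indicator MeasurableSet.of_discrete)
  rw [integral_indicator_one MeasurableSet.of_discrete] at h
  have htsum : ∑' y, μ.real {y} • D.indicator (1 : (Fin n → Y) → ℝ) y =
      ∑' y, D.indicator (fun y => ∏ k, (P k (y k)).toReal) y :=
    tsum_congr fun y => by by_cases hy : y ∈ D <;> simp [hy, hpt]
  rw [h, htsum]
  exact (hs.indicator D).hasSum

/-- Distributions that are reliably distinguished by some region have a small Bhattacharyya
coefficient. -/
lemma prod_bhattacharyya_le {Y : Type*} [Countable Y] [MeasurableSpace Y]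
    [DiscreteMeasurableSpace Y] {n : ℕ} (P Q : Fin n → PMF Y) (D : Set (Fin n → Y)) {lam : ℝ}
    (hlam : 0 < lam) (hP : 1 - lam ≤ (Measure.pi fun k => (P k).toMeasure).real D)
    (hQ : (Measure.pi fun k => (Q k).toMeasure).real D ≤ lam) :
    ∏ k, bhattacharyya (P k) (Q k) ≤ 2 * √lam := by
  set μ := Measure.pi fun k => (P k).toMeasure
  set ν := Measure.pi fun k => (Q k).toMeasure
  have hμc : μ.real Dᶜ ≤ lam := by
    rw [probReal_compl_eq_one_sub MeasurableSet.of_discrete]; linarith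
  have hμ1 : μ.real D ≤ 1 := measureReal_le_one
  have hν1 : ν.real Dᶜ ≤ 1 := measureReal_le_one
  have hc : 0 < √lam := Real.sqrt_pos.2 hlam
  have hsum := hasSum_prod_words (fun k y => √((P k y).toReal * (Q k y).toReal)) fun k =>
    summable_sqrt_mul (fun _ => ENNReal.toReal_nonneg) (fun _ => ENNReal.toReal_nonneg)
      (P k).summable_toReal (Q k).summable_toReal
  -- AM-GM with parameter `√lam`, the roles of `P` and `Q` being exchanged off `D`: each of the four
  -- masses then contributes at most `√lam`.
  have hbound := ((((hasSum_indicator_measureReal_pi P D).mul_left (√lam)).add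
    ((hasSum_indicator_measureReal_pi Q D).div_const (√lam))).add
    (((hasSum_indicator_measureReal_pi Q Dᶜ).mul_left (√lam)).add
    ((hasSum_indicator_measureReal_pi P Dᶜ).div_const (√lam)))).div_const 2
  have hle := hasSum_le (fun y => ?_) hsum hbound
  · refine hle.trans ?_
    have h1 : ν.real D / √lam ≤ √lam := by
      rw [div_le_iff₀ hc, Real.mul_self_sqrt hlam.le]; exact hQ
    have h2 : μ.real Dᶜ / √lam ≤ √lam := by
      rw [div_le_iff₀ hc, Real.mul_self_sqrt hlam.le]; exact hμc
    nlinarith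
  · rw [show ∏ k, √((P k (y k)).toReal * (Q k (y k)).toReal) =
      √((∏ k, (P k (y k)).toReal) * ∏ k, (Q k (y k)).toReal) by
        rw [← Finset.prod_mul_distrib, Real.sqrt_prod _ fun _ _ => by positivity]]
    have hp : 0 ≤ ∏ k, (P k (y k)).toReal := Finset.prod_nonneg fun _ _ => ENNReal.toReal_nonneg
    have hq : 0 ≤ ∏ k, (Q k (y k)).toReal := Finset.prod_nonneg fun _ _ => ENNReal.toReal_nonneg
    by_cases hy : y ∈ D
    · simpa [hy] using sqrt_mul_le_half_add hp hq hc
    · have := sqrt_mul_le_half_add hq hp hc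
      rw [mul_comm] at this
      simpa [hy] using this

/-- Two words that agree up to the radius of a fine cover cannot be told apart. -/
lemma two_mul_sqrt_lt_prod_bhattacharyya {Y : Type*} {n : ℕ} (P Q : Fin n → PMF Y) {E : ℝ}
    (hE0 : 0 ≤ E) (hE1 : E ≤ 1) (hnE : 4 ≤ n * E)
    (h : ∀ k, dist (sqrtPMF (P k)) (sqrtPMF (Q k)) ^ 2 ≤ E / 8) :
    2 * √((2 : ℝ) ^ (-(n * E))) < ∏ k, bhattacharyya (P k) (Q k) := by
  have hB : ∀ k, 1 - E / 16 ≤ bhattacharyya (P k) (Q k) := fun k => by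
    have := h k
    rw [dist_sqrtPMF_sq] at this
    linarith
  have h1 : (1 - E / 16) ^ n ≤ ∏ k, bhattacharyya (P k) (Q k) := by
    calc (1 - E / 16) ^ n = ∏ _k : Fin n, (1 - E / 16) := by simp
      _ ≤ _ := Finset.prod_le_prod (fun _ _ => by linarith) fun k _ => hB k
  refine lt_of_lt_of_le ?_ h1
  have h2 : Real.exp (-(E / 8)) ≤ 1 - E / 16 := by
    rw [← Real.le_log_iff_exp_le (by linarith)]
    refine le_trans ?_ (Real.one_sub_inv_le_log_of_pos (by linarith))
    have h3 : (1 - E / 16)⁻¹ ≤ 1 + E / 8 := by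
      rw [inv_le_iff_one_le_mul₀ (by linarith)]
      nlinarith
    linarith
  refine lt_of_lt_of_le ?_ (pow_le_pow_left₀ (Real.exp_pos _).le h2 n)
  rw [← Real.exp_nat_mul, Real.sqrt_eq_rpow, ← Real.rpow_mul two_pos.le,
    Real.rpow_def_of_pos two_pos]
  nth_rewrite 1 [← Real.exp_log two_pos]
  rw [← Real.exp_add]
  refine Real.exp_lt_exp.2 ?_
  -- The claim is now `log 2 * (1 - nE / 2) < -nE / 8`, which `4 ≤ nE` guarantees.
  have := Real.log_two_gt_d9
  have := Real.log_two_lt_d9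
  nlinarith

/-- Code words fall into different cells of a fine cover of the image of the channel. -/
lemma card_le_of_isCover {X Y : Type*} [Countable Y] [MeasurableSpace Y]
    [DiscreteMeasurableSpace Y] {W : X → PMF Y} {n N : ℕ} {E : ℝ} (hE0 : 0 ≤ E) (hE1 : E ≤ 1)
    (hnE : 4 ≤ n * E) (hcode : ExistsDICode W n N ((2 : ℝ) ^ (-(n * E))) ((2 : ℝ) ^ (-(n * E))))
    {r : ℝ≥0} (hr : (r : ℝ) ^ 2 = E / 32) {C : Finset (lp (fun _ : Y => ℝ) 2)}
    (hC : Metric.IsCover r (Set.range fun x => sqrtPMF (W x)) C) : N ≤ C.card ^ n := by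
  obtain ⟨u, D, hD⟩ := hcode
  have hcell : ∀ x, ∃ c : C, dist (sqrtPMF (W x)) c ≤ r := by
    intro x
    obtain ⟨c, hc, hd⟩ := hC ⟨x, rfl⟩
    refine ⟨⟨c, by simpa using hc⟩, ?_⟩
    have hd' : edist (sqrtPMF (W x)) c ≤ r := hd
    rw [edist_dist, ENNReal.ofReal_le_iff_le_toReal ENNReal.coe_ne_top] at hd'
    simpa using hd'
  choose cell hcell using hcell
  have hinj : Function.Injective fun (i : Fin N) (k : Fin n) => cell (u i k) := by
    intro i j hij
    by_contra hne
    refine absurd (prod_bhattacharyya_le (fun k => W (u i k)) (fun k => W (u j k)) (D i) hD.pos₁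
      (hD.missed i) (hD.false_id j i (Ne.symm hne))) (not_le.2 ?_)
    -- Letters in one cell are at distance at most `2r`, and `(2r)² = E / 8`.
    refine two_mul_sqrt_lt_prod_bhattacharyya _ _ hE0 hE1 hnE fun k => ?_
    have hk : cell (u i k) = cell (u j k) := congrFun hij k
    have h1 := hcell (u i k)
    have h2 := hcell (u j k)
    rw [← hk, dist_comm] at h2
    have h3 : dist (sqrtPMF (W (u i k))) (sqrtPMF (W (u j k))) ≤ 2 * r :=
      (dist_triangle _ _ _).trans (by linarith)
    have := pow_le_pow_left₀ dist_nonneg h3 2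
    nlinarith
  simpa using Fintype.card_le_of_injective _ hinj

/-- The bound on covering numbers that comes with the dimension. -/
lemma eventually_log_coveringNumber_le {M : Type*} [PseudoMetricSpace M] {A : Set M} {d : ℝ}
    (h : upperMinkowskiDim A < d) :
    ∀ᶠ r : ℝ≥0 in 𝓝[>] 0, ∃ C : Finset M, Metric.IsCover r A C ∧
      (C.Nonempty → Real.log C.card ≤ d * Real.log (1 / r)) := by
  have h1 := eventually_lt_of_limsup_lt h
  have h2 : ∀ᶠ r : ℝ≥0 in 𝓝[>] 0, r < 1 := eventually_nhdsWithin_of_eventually_nhds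
    (eventually_lt_nhds one_pos)
  filter_upwards [h1, h2, self_mem_nhdsWithin] with r hr hr1 hr0
  have hr0' : (0 : ℝ) < r := hr0
  have hlog : 0 < Real.log (1 / r) := Real.log_pos (by
    rw [lt_div_iff₀ hr0']; simpa using hr1)
  rw [EReal.div_lt_iff (by exact_mod_cast hlog) (EReal.coe_ne_top _)] at hr
  have hfin : Metric.coveringNumber r A ≠ ⊤ := by
    intro htop
    rw [htop] at hr
    simp at hr
  obtain ⟨C, -, hCfin, hcov, hcard⟩ := Metric.exists_set_encard_eq_coveringNumber hfin
  lift C to Finset M using hCfin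
  refine ⟨C, hcov, fun hne => ?_⟩
  rw [← hcard, Set.encard_coe_eq_coe_finsetCard] at hr
  have hpos : (C.card : ℝ≥0∞) ≠ 0 := by
    simpa using hne.ne_empty
  simp only [ENat.toENNReal_coe] at hr
  rw [ENNReal.log_pos_real hpos (ENNReal.natCast_ne_top _), ENNReal.toReal_natCast] at hr
  exact_mod_cast hr.le

/-! ### Leading order for small exponents -/

lemma ExistsDICode.mono {X Y : Type*} [MeasurableSpace Y] {W : X → PMF Y} {n N : ℕ}
    {lam₁ lam₂ lam₁' lam₂' : ℝ} (h : ExistsDICode W n N lam₁ lam₂) (h₁ : lam₁ ≤ lam₁')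
    (h₂ : lam₂ ≤ lam₂') : ExistsDICode W n N lam₁' lam₂' := by
  obtain ⟨u, D, hD⟩ := h
  exact ⟨u, D, hD.pos₁.trans_le h₁, hD.pos₂.trans_le h₂, fun i => by linarith [hD.missed i],
    fun i j hij => (hD.false_id i j hij).trans h₂⟩

lemma tendsto_exponent_nhdsGT_zero {E : ℕ → ℝ}
    (h₁ : Tendsto (fun n : ℕ => (n : ℝ) * E n) atTop atTop)
    (h₂ : Tendsto (fun n : ℕ => E n * Real.logb 2 n) atTop (𝓝 0)) :
    Tendsto E atTop (𝓝[>] 0) := by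
  have hpos : ∀ᶠ n in atTop, 0 < E n := by
    filter_upwards [h₁.eventually_gt_atTop 0] with n hn
    exact pos_of_mul_pos_right hn (Nat.cast_nonneg _)
  refine tendsto_nhdsWithin_iff.2 ⟨?_, hpos⟩
  refine squeeze_zero' (hpos.mono fun _ h => h.le) ?_ h₂
  filter_upwards [hpos, eventually_ge_atTop 2] with n hn hn2
  refine le_mul_of_one_le_right hn.le ?_
  rw [Real.le_logb_iff_rpow_le one_lt_two (by positivity), Real.rpow_one]
  exact_mod_cast hn2

lemma tendsto_logb_one_div {E : ℕ → ℝ} (h : Tendsto E atTop (𝓝[>] 0)) :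
    Tendsto (fun n => Real.logb 2 (1 / E n)) atTop atTop := by
  simp only [one_div]
  exact (Real.tendsto_logb_atTop one_lt_two).comp (tendsto_inv_nhdsGT_zero.comp h)

/-- Achievability with equal error exponents, at leading order. -/
lemma eventually_exists_code {X Y : Type*} [Countable Y] [MeasurableSpace Y]
    [DiscreteMeasurableSpace Y] {W : X → PMF Y} (hW : BernoulliReducible W) {E : ℕ → ℝ}
    (h₁ : Tendsto (fun n : ℕ => (n : ℝ) * E n) atTop atTop)
    (hE : Tendsto E atTop (𝓝[>] 0)) {ε : ℝ} (hε : 0 < ε) :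
    ∀ᶠ n : ℕ in atTop, ∃ N : ℕ, 1 ≤ N ∧
      ExistsDICode W n N ((2 : ℝ) ^ (-(n * E n))) ((2 : ℝ) ^ (-(n * E n))) ∧
      (1 / 2 - ε) * Real.logb 2 (1 / E n) ≤ linearRate n N := by
  obtain ⟨L, hLε, hL⟩ :=
    ((tendsto_layerLoss.eventually_lt_const hε).and (eventually_gt_atTop 0)).exists
  obtain ⟨C, hC⟩ := exists_code_linearRate_ge hW hL
  filter_upwards [h₁.eventually_ge_atTop (L : ℝ), eventually_gt_atTop 0,
    (tendsto_nhdsWithin_iff.1 hE).2,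
    (tendsto_logb_one_div hE).eventually_ge_atTop ((|C| + 1) / (ε / 2))] with n hnL hn hE0 hlog
  replace hE0 : 0 < E n := hE0
  -- Doubling the exponent absorbs the factor `L` in the first error once `L ≤ n * E n`, and lowers
  -- `log (1 / E)` by only 1.
  obtain ⟨N, hN, hcode, hrate⟩ := hC n hn (2 * E n) (by linarith)
  have hsplit : -((n : ℝ) * (2 * E n)) = -(n * E n) + -(n * E n) := by ring
  have hpow : (0 : ℝ) < (2 : ℝ) ^ (-(n * E n)) := by positivity
  have hLpow : L * (2 : ℝ) ^ (-(n * E n)) ≤ 1 := by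
    rw [Real.rpow_neg two_pos.le, ← div_eq_mul_inv, div_le_one (by positivity)]
    calc (L : ℝ) ≤ (2 : ℝ) ^ (L : ℝ) := by
          rw [Real.rpow_natCast]; exact_mod_cast Nat.lt_two_pow_self.le
      _ ≤ _ := Real.rpow_le_rpow_of_exponent_le one_le_two hnL
  refine ⟨N, hN, hcode.mono ?_ ?_, ?_⟩
  · rw [hsplit, Real.rpow_add two_pos, ← mul_assoc]
    exact mul_le_of_le_one_left hpow.le hLpow
  · refine Real.rpow_le_rpow_of_exponent_le one_le_two ?_
    have : 0 < (n : ℝ) * E n := by positivity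
    linarith
  · refine le_trans ?_ hrate
    have h2 : Real.logb 2 (1 / (2 * E n)) = Real.logb 2 (1 / E n) - 1 := by
      rw [one_div, one_div, Real.logb_inv, Real.logb_inv, Real.logb_mul two_ne_zero hE0.ne',
        Real.logb_self_eq_one one_lt_two]
      ring
    rw [h2]
    rw [div_le_iff₀ (by positivity)] at hlog
    have h3 := le_abs_self C
    have h4 := layerLoss_pos L
    have h5 : 0 ≤ Real.logb 2 (1 / E n) := by
      by_contra hneg
      have := abs_nonneg C
      nlinarith
    nlinarith

/-- Converse with equal error exponents, at leading order. -/
lemma eventually_linearRate_le {X Y : Type*} [Countable Y] [MeasurableSpace Y]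
    [DiscreteMeasurableSpace Y] {W : X → PMF Y} (hdim : imageDim W = 1) {E : ℕ → ℝ}
    (h₁ : Tendsto (fun n : ℕ => (n : ℝ) * E n) atTop atTop)
    (hE : Tendsto E atTop (𝓝[>] 0)) {ε : ℝ} (hε : 0 < ε) :
    ∀ᶠ n : ℕ in atTop, ∀ N : ℕ,
      ExistsDICode W n N ((2 : ℝ) ^ (-(n * E n))) ((2 : ℝ) ^ (-(n * E n))) →
      linearRate n N ≤ (1 / 2 + ε) * Real.logb 2 (1 / E n) := by
  have hdim' : upperMinkowskiDim (Set.range fun x => sqrtPMF (W x)) < ((1 + ε : ℝ) : EReal) := by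
    rw [imageDim] at hdim
    rw [hdim]
    exact_mod_cast (by linarith : (1 : ℝ) < 1 + ε)
  have hr : Tendsto (fun n => Real.toNNReal √(E n / 32)) atTop (𝓝[>] 0) := by
    obtain ⟨hE0, hEpos⟩ := tendsto_nhdsWithin_iff.1 hE
    refine tendsto_nhdsWithin_iff.2 ⟨?_, ?_⟩
    · have h : Tendsto (fun n => √(E n / 32)) atTop (𝓝 0) := by
        simpa using (hE0.div_const 32).sqrt
      rw [← Real.toNNReal_zero]
      exact (continuous_real_toNNReal.tendsto 0).comp h
    · filter_upwards [hEpos] with n hn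
      replace hn : 0 < E n := hn
      exact Real.toNNReal_pos.2 (Real.sqrt_pos.2 (by positivity))
  filter_upwards [hr.eventually (eventually_log_coveringNumber_le hdim'),
    h₁.eventually_ge_atTop 4, eventually_gt_atTop 0, (tendsto_nhdsWithin_iff.1 hE).2,
    (tendsto_nhdsWithin_iff.1 hE).1.eventually_le_const one_pos,
    (tendsto_logb_one_div hE).eventually_ge_atTop (5 * (1 + ε) / ε)]
    with n hcov hnE hn hE0 hE1 hlog N hcode
  replace hE0 : 0 < E n := hE0
  have hn' : (0 : ℝ) < n := by exact_mod_cast hn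
  rw [div_le_iff₀ hε] at hlog
  obtain ⟨C, hC, hcard⟩ := hcov
  have hrr : ((Real.toNNReal √(E n / 32) : ℝ≥0) : ℝ) = √(E n / 32) :=
    Real.coe_toNNReal _ (Real.sqrt_nonneg _)
  have hle := card_le_of_isCover hE0.le hE1 hnE hcode
    (by rw [hrr, Real.sq_sqrt (by positivity)]) hC
  have hlog0 : 0 ≤ Real.logb 2 (1 / E n) := Real.logb_nonneg one_lt_two (by
    rw [le_div_iff₀ hE0]; linarith)
  rcases Nat.eq_zero_or_pos N with rfl | hN
  · simp only [linearRate, Nat.cast_zero, Real.logb_zero, zero_div]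
    positivity
  have hCne : C.Nonempty := by
    rw [Finset.nonempty_iff_ne_empty]
    rintro rfl
    simp [hn.ne'] at hle
    omega
  have hCpos : (0 : ℝ) < C.card := by exact_mod_cast hCne.card_pos
  have h2 : Real.logb 2 N ≤ n * Real.logb 2 C.card := by
    rw [← Real.logb_pow]
    exact Real.logb_le_logb_of_le one_lt_two (by exact_mod_cast hN) (by exact_mod_cast hle)
  -- The 5 is `log₂ 32` from the radius `√(E / 32)`; the lower bound `hlog` on `log (1 / E)` absorbs
  -- it into `ε`.
  have h3 : Real.logb 2 C.card ≤ (1 + ε) * ((Real.logb 2 (1 / E n) + 5) / 2) := by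
    have h4 := div_le_div_of_nonneg_right (hcard hCne) (Real.log_pos one_lt_two).le
    rw [mul_div_assoc, Real.log_div_log, Real.log_div_log, hrr] at h4
    have h5 : Real.logb 2 (1 / √(E n / 32)) = (Real.logb 2 (1 / E n) + 5) / 2 := by
      rw [one_div, one_div, Real.logb_inv, Real.logb_inv, Real.sqrt_eq_rpow,
        Real.logb_rpow_eq_mul_logb_of_pos (by positivity), Real.logb_div hE0.ne' (by norm_num),
        show (32 : ℝ) = 2 ^ (5 : ℝ) by norm_num, Real.logb_rpow two_pos (by norm_num)]
      ring
    rwa [h5] at h4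
  rw [linearRate, div_le_iff₀ hn']
  have h6 := mul_le_mul_of_nonneg_left h3 hn'.le
  have h7 := mul_le_mul_of_nonneg_left hlog hn'.le
  linarith

theorem mainTheorem6 {X Y : Type*} [Countable Y] [MeasurableSpace Y] [DiscreteMeasurableSpace Y]
    (W : X → PMF Y) (hW : BernoulliReducible W) :
    -- achievability, with a constant `C` that depends on neither `n` nor the exponent
    (∀ δ : ℝ, 0 < δ → ∀ L : ℕ, 1 ≤ L → ∃ (C : ℝ) (n₀ : ℕ), ∀ n : ℕ, n₀ ≤ n →
      ∀ E : ℝ, 0 < E → E < 1 / (δ * Real.logb 2 n) →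
        ∃ N : ℕ, 1 ≤ N ∧
          ExistsDICode W n N (L * (2 : ℝ) ^ (-(n * E))) ((2 : ℝ) ^ (-(n * E))) ∧
          (1 - layerLoss L) / 2 * Real.logb 2 (1 / E - δ * Real.logb 2 n) - C ≤ linearRate n N) ∧
    -- for small exponents, achievability and converse agree at leading order
    (imageDim W = 1 → ∀ E : ℕ → ℝ,
      Tendsto (fun n : ℕ => (n : ℝ) * E n) atTop atTop →
      Tendsto (fun n : ℕ => E n * Real.logb 2 n) atTop (𝓝 0) →
      ∀ ε : ℝ, 0 < ε → ∀ᶠ n : ℕ in atTop,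
        (∃ N : ℕ, 1 ≤ N ∧
          ExistsDICode W n N ((2 : ℝ) ^ (-(n * E n))) ((2 : ℝ) ^ (-(n * E n))) ∧
          (1 / 2 - ε) * Real.logb 2 (1 / E n) ≤ linearRate n N) ∧
        (∀ N : ℕ, ExistsDICode W n N ((2 : ℝ) ^ (-(n * E n))) ((2 : ℝ) ^ (-(n * E n))) →
          linearRate n N ≤ (1 / 2 + ε) * Real.logb 2 (1 / E n))) := by

  constructor
  · intro δ hδ L hL
    obtain ⟨C, hC⟩ := exists_code_linearRate_ge hW hL
    refine ⟨C, 1, fun n hn E hE hEδ => ?_⟩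
    obtain ⟨N, hN, hcode, hrate⟩ := hC n hn E hE
    refine ⟨N, hN, hcode, le_trans ?_ hrate⟩
    have hlogn : 0 ≤ δ * Real.logb 2 n :=
      mul_nonneg hδ.le (Real.logb_nonneg one_lt_two (by exact_mod_cast hn))
    have hpos : 0 < 1 / E - δ * Real.logb 2 n := by
      -- At `n = 1` the bound on `E` is a division by zero and reads `E < 0`, so that case is void.
      rcases hlogn.eq_or_lt with h0 | h0
      · rw [← h0, div_zero] at hEδ
        linarith
      · rw [lt_div_iff₀ h0] at hEδ
        rw [sub_pos, lt_div_iff₀ hE]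
        linarith
    have hle : Real.logb 2 (1 / E - δ * Real.logb 2 n) ≤ Real.logb 2 (1 / E) :=
      Real.logb_le_logb_of_le one_lt_two hpos (by linarith)
    have hη := layerLoss_le_one L
    gcongr
  · intro hdim E h₁ h₂ ε hε
    have hE := tendsto_exponent_nhdsGT_zero h₁ h₂
    filter_upwards [eventually_exists_code hW h₁ hE hε, eventually_linearRate_le hdim h₁ hE hε]
      with n ha hc
    exact ⟨ha, hc⟩
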